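/- For an even integer $n\ge 16$, let $W_{4,n}$ be the $4$-regular Knödel graph of order $n$: the bipartite graph with vertices $(i,j)$, $i\in\{1,2\}$, $0\le j\le n/2-1$, whose edges join $(1,j)$ to $(2,(j+2^k-1)\bmod (n/2))$ for every $0\le j\le n/2-1$ and $k=0,1,2,3$. The domination number $\gamma(G)$ of a finite graph $G$ is the minimum cardinality of a set $D$ of vertices such that every vertex outside $D$ is adjacent to a vertex of $D$. Then, for every even integer $n\ge 16$, $$\gamma(W_{4,n})=2\left\lfloor\frac{n}{10}\right\rfloor+\begin{cases}0 & \text{if } n\equiv 0 \pmod{10},\\ 2 & \text{if } n\in\{16,18,36\} \text{ or } n\equiv 2,4 \pmod{10},\\ 3 & \text{if } n=28, \text{ or } n\equiv 6 \pmod{10} \text{ and } n\notin\{16,36\},\\ 4 & \text{if } n\equiv 8 \pmod{10} \text{ and } n\notin\{18,28\}.\end{cases}$$ -/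

import Mathlib

/-- A set `D` of vertices is dominating if every vertex outside `D` is adjacent to some
vertex of `D`. -/
def IsDominatingSet {V : Type*} (G : SimpleGraph V) (D : Finset V) : Prop :=
  ∀ u : V, u ∉ D → ∃ v ∈ D, G.Adj u v

/-- The domination number: the minimum cardinality of a dominating set of a finite graph. The
minimum is attained, see `exists_isDominatingSet_card_eq`. -/
noncomputable def dominationNumber {V : Type*} [Fintype V] (G : SimpleGraph V) : ℕ :=
  sInf {k : ℕ | ∃ D : Finset V, IsDominatingSet G D ∧ D.card = k}

theorem exists_isDominatingSet_card_eq {V : Type*} [Fintype V] (G : SimpleGraph V) :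
    ∃ D : Finset V, IsDominatingSet G D ∧ D.card = dominationNumber G :=
  Nat.sInf_mem (s := {k : ℕ | ∃ D : Finset V, IsDominatingSet G D ∧ D.card = k})
    ⟨_, Finset.univ, fun u hu => absurd (Finset.mem_univ u) hu, rfl⟩

/-- The Knödel graph `W_{Δ,n}` (for `n ≥ 2` even and `1 ≤ Δ ≤ ⌊log₂ n⌋`). The vertex `(1, j)` is
`Sum.inl j` and the vertex `(2, j)` is `Sum.inr j`, for `0 ≤ j ≤ n / 2 - 1`. There is an edge
between `(1, j)` and `(2, (j + 2 ^ k - 1) mod (n / 2))` for `k = 0, …, Δ - 1`, and no other edge.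
The subtraction is exact because `2 ^ k ≥ 1`. -/
def knodelGraph (Δ n : ℕ) : SimpleGraph (Fin (n / 2) ⊕ Fin (n / 2)) where
  Adj
    | Sum.inl i, Sum.inr j => ∃ k < Δ, (j : ℕ) = ((i : ℕ) + 2 ^ k - 1) % (n / 2)
    | Sum.inr j, Sum.inl i => ∃ k < Δ, (j : ℕ) = ((i : ℕ) + 2 ^ k - 1) % (n / 2)
    | Sum.inl _, Sum.inl _ => False
    | Sum.inr _, Sum.inr _ => False
  symm := ⟨by rintro (i | i) (j | j) h <;> exact h⟩
  loopless := ⟨by rintro (i | i) h <;> exact h⟩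

/-!
Write `m = n / 2 = 5 t + r`, and let `A` and `B` be the sets of indices modulo `m` of the vertices
of a dominating set on the first and on the second side. A vertex dominates itself and its four
neighbours, so the surpluses `v = 4 |A| + |B| - m` and `u = |A| + 4 |B| - m`, which count the
superfluous dominations of vertices of the second and of the first side, are nonnegative. A
dominating set smaller than claimed is so small that, up to the automorphism `(1, z) ↔ (2, -z)`,
the surpluses are at most 2 and 5.

Read the dominating set as a walk around the cycle `ℤ / m`, whose state at `x` consists of the
membership bits of the seven indices from `x` on, on both sides. Whether the next bits leave a
vertex undominated, and how much surplus they add, depends on the state only. With total surplus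
that small very little freedom is left. Call regular a certain state of the perfect pattern of
period 5, `A = {5 i}`, `B = {5 i + 4}`. A walk from the regular state that stays within the
surpluses returns to it within 20 steps, and at the first return `u = 4 v`
(`returnSearch_eq_true`). A walk of 33 steps that starts after two steps without surplus and stays
within the surpluses meets the regular state, and the shorter closed walks which avoid it have `u
= 4 v` or one of a few lengths (`calmSearch_eq_true`). Both are finite searches, verified by
evaluation in the kernel; `search_sound` transfers them to dominating sets. So `u = 4 v` in all
cases of interest. As `4 v - u = 3 (5 |A| - m)`, this means `m = 5 |A|` (`eq_five_mul`), which the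
sizes of `A` and `B` exclude (`IsDominatingPair.lower_bound`).

For the upper bounds, the perfect pattern of period 5 is completed by at most four vertices
(`dominationNumber_knodelGraph_le_of_residue`). The orders 16, 18, 28 and 36 have smaller
dominating sets of their own.
-/

namespace Knodel

open Finset

/-! ### Walks in the space of windows -/

/-- The number of vertices of a set `D` that dominate the vertex `(2, x + 7)`, where `h` encodes
the seven indicator bits of `D` at `(1, x), …, (1, x + 6)` (the bit of `x` being the most
significant one), and `a`, `b` are the bits at `(1, x + 7)` and `(2, x + 7)`. -/
def coverV (h a b : ℕ) : ℕ := h / 64 + h / 4 % 2 + h % 2 + a + b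

/-- The number of vertices of a set `D` that dominate the vertex `(1, x)`, where `h` and `k` encode
the seven bits of `D` from `(1, x)` and from `(2, x)` on, and `b` is the bit at `(2, x + 7)`. -/
def coverU (h k b : ℕ) : ℕ := h / 64 + k / 64 + k / 32 % 2 + k / 8 % 2 + b

/-- The window of seven bits that results from `h` by dropping the oldest bit and appending `a`. -/
def shift (h a : ℕ) : ℕ := (2 * h + a) % 128

/-- The pair of windows with `(1, x), (1, x + 5), (2, x + 4)` as the only vertices of `D`. It occurs
in the perfect dominating pattern of period 5 formed by the `(1, 5 i)` and the `(2, 5 i + 4)`. -/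
def isRegular (h k : ℕ) : Bool := Nat.beq h 66 && Nat.beq k 4

theorem isRegular_iff (h k : ℕ) : isRegular h k = true ↔ h = 66 ∧ k = 4 := by
  simp [isRegular, Nat.beq_eq]

/-- Depth-first search over the ways to continue a pair of windows `(h, k)` by `n` further
positions, one bit on each side per step, so that every vertex whose neighbourhood gets completed
is dominated, with a total surplus of at most `p` on the second side and at most `q` on the first.
A branch ends when it reaches the regular pair of windows, where `goal` is required of the
remaining allowances, or after `n` steps, where `leaf` is required of the windows. At each other
pair of windows `visit` is required of the number of steps left, the windows, and the allowances
left. The comparisons are the Boolean ones of `ℕ`, which the kernel evaluates quickly. -/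
def search (leaf : ℕ → ℕ → Bool) (visit : ℕ → ℕ → ℕ → ℕ → ℕ → Bool) (goal : ℕ → ℕ → Bool) :
    ℕ → ℕ → ℕ → ℕ → ℕ → Bool
  | 0, h, k, _, _ => leaf h k
  | n + 1, h, k, p, q =>
    let branch (a b : ℕ) : Bool :=
      bif Nat.ble 1 (coverV h a b) && (Nat.ble (coverV h a b) (p + 1) &&
          (Nat.ble 1 (coverU h k b) && Nat.ble (coverU h k b) (q + 1))) then
        bif isRegular (shift h a) (shift k b) then
          goal (p + 1 - coverV h a b) (q + 1 - coverU h k b)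
        else
          visit n (shift h a) (shift k b) (p + 1 - coverV h a b) (q + 1 - coverU h k b) &&
          search leaf visit goal n (shift h a) (shift k b)
            (p + 1 - coverV h a b) (q + 1 - coverU h k b)
      else true
    branch 0 0 && (branch 0 1 && (branch 1 0 && branch 1 1))

/-- Whether `f` holds at all numbers below the given bound. -/
def allBelow (f : ℕ → Bool) : ℕ → Bool
  | 0 => true
  | n + 1 => f n && allBelow f n

theorem of_allBelow {f : ℕ → Bool} {n : ℕ} (h : allBelow f n = true) {i : ℕ} (hi : i < n) :
    f i = true := by
  induction n with
  | zero => omega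
  | succ n ih =>
    rw [allBelow, Bool.and_eq_true] at h
    obtain rfl | hlt := Nat.eq_or_lt_of_le (Nat.le_of_lt_succ hi)
    · exact h.1
    · exact ih h.2 hlt

/-- The `visit` condition for a walk of `33 - n` steps that starts at `(h, k)` with allowances 2
and 5 and is now at `(h', k')` with allowances `p` and `q` left: if the walk is closed, then the
surplus `5 - q` is four times the surplus `2 - p`, or the length is at most twice the total
surplus, or the length is 9 or 18. These two lengths are true exceptions. -/
def closingTest (h k n h' k' p q : ℕ) : Bool :=
  !(Nat.beq h h' && Nat.beq k k') || (Nat.beq (q + 3) (4 * p) ||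
    (Nat.ble (33 - n) (2 * (7 - (p + q))) || (Nat.beq (33 - n) 9 || Nat.beq (33 - n) 18)))

/-- The search for closed walks through `(h, k)` that avoid the regular windows and violate
`closingTest`. The `leaf` condition makes it fail if some walk lasts for 33 steps. -/
def closedSearch (h k : ℕ) : Bool :=
  search (fun _ _ => false) (closingTest h k) (fun _ _ => true) 33 h k 2 5

/-- Two steps without surplus, followed by `closedSearch`. -/
def calmSearch (h k : ℕ) : Bool :=
  search closedSearch (fun _ _ _ _ _ => true) (fun _ _ => true) 2 h k 0 0

/-- From whatever windows two steps without surplus lead to while avoiding the regular ones, each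
closed walk with surpluses at most 2 and 5 meets the regular windows or satisfies `closingTest`,
and each such walk of 33 steps meets the regular windows. -/
theorem calmSearch_eq_true :
    allBelow (fun h => allBelow (fun k => calmSearch h k) 128) 128 = true := by
  decide +kernel

/-- A walk that leaves the regular windows with allowances 2 and 5 returns to them within 20 steps
or exceeds an allowance, and at its first return the surplus on the first side is four times that
on the second. -/
theorem returnSearch_eq_true :
    search (fun _ _ => false) (fun _ _ _ _ _ => true) (fun p q => Nat.beq (q + 3) (4 * p))
      20 66 4 2 5 = true := by
  decide +kernel

/-! ### Dominating pairs as walks -/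

section Walk

variable {m : ℕ}

/-- The window of the seven values of `A` from `x` on, encoded in binary for a `0`-`1`-valued `A`.
-/
def history (A : ZMod m → ℕ) (x : ZMod m) : ℕ :=
  64 * A x + 32 * A (x + 1) + 16 * A (x + 2) + 8 * A (x + 3) + 4 * A (x + 4) + 2 * A (x + 5)
    + A (x + 6)

theorem shift_history {A : ZMod m → ℕ} (hA : ∀ z, A z ≤ 1) (x : ZMod m) :
    shift (history A x) (A (x + 7)) = history A (x + 1) := by
  have e1 : x + 1 + 1 = x + 2 := by ring
  have e2 : x + 1 + 2 = x + 3 := by ring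
  have e3 : x + 1 + 3 = x + 4 := by ring
  have e4 : x + 1 + 4 = x + 5 := by ring
  have e5 : x + 1 + 5 = x + 6 := by ring
  have e6 : x + 1 + 6 = x + 7 := by ring
  simp only [shift, history, e1, e2, e3, e4, e5, e6]
  have := hA x; have := hA (x + 1); have := hA (x + 2); have := hA (x + 3); have := hA (x + 4)
  have := hA (x + 5); have := hA (x + 6); have := hA (x + 7)
  omega

/-- For the indicator functions `A` and `B` of the two sides of a vertex set: the number of its
vertices that dominate `(2, x + 7)`. -/
def multV (A B : ZMod m → ℕ) (x : ZMod m) : ℕ :=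
  A x + A (x + 4) + A (x + 6) + A (x + 7) + B (x + 7)

/-- For the indicator functions `A` and `B` of the two sides of a vertex set: the number of its
vertices that dominate `(1, x)`. -/
def multU (A B : ZMod m → ℕ) (x : ZMod m) : ℕ :=
  A x + B x + B (x + 1) + B (x + 3) + B (x + 7)

theorem coverV_history {A : ZMod m → ℕ} (hA : ∀ z, A z ≤ 1) (B : ZMod m → ℕ) (x : ZMod m) :
    coverV (history A x) (A (x + 7)) (B (x + 7)) = multV A B x := by
  have := hA x; have := hA (x + 1); have := hA (x + 2); have := hA (x + 3); have := hA (x + 4)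
  have := hA (x + 5); have := hA (x + 6)
  simp only [coverV, history, multV]
  omega

theorem coverU_history {A B : ZMod m → ℕ} (hA : ∀ z, A z ≤ 1) (hB : ∀ z, B z ≤ 1) (x : ZMod m) :
    coverU (history A x) (history B x) (B (x + 7)) = multU A B x := by
  have e1 : (64 * A x + 32 * A (x + 1) + 16 * A (x + 2) + 8 * A (x + 3) + 4 * A (x + 4)
    + 2 * A (x + 5) + A (x + 6)) / 64 = A x := by
    have := hA x; have := hA (x + 1); have := hA (x + 2); have := hA (x + 3); have := hA (x + 4)
    have := hA (x + 5); have := hA (x + 6)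
    omega
  have := hB x; have := hB (x + 1); have := hB (x + 2); have := hB (x + 3); have := hB (x + 4)
  have := hB (x + 5); have := hB (x + 6)
  simp only [coverU, history, multU, e1]
  omega

/-- `A` and `B` are the indicator functions of the two sides of a dominating set. -/
structure IsDominatingPair (A B : ZMod m → ℕ) : Prop where
  left_le_one : ∀ z, A z ≤ 1
  right_le_one : ∀ z, B z ≤ 1
  one_le_multV : ∀ z, 1 ≤ multV A B z
  one_le_multU : ∀ z, 1 ≤ multU A B z

/-- The sum of `f - 1` over the `t` successive positions from `x` on. For a dominating pair and
`f = multV A B` or `f = multU A B`, where `f ≥ 1`, this is the surplus gathered by `t` steps. -/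
def partialExcess (f : ZMod m → ℕ) (x : ZMod m) (t : ℕ) : ℕ :=
  ∑ i ∈ range t, (f (x + (i : ZMod m)) - 1)

theorem partialExcess_add (f : ZMod m → ℕ) (x : ZMod m) (s t : ℕ) :
    partialExcess f x (s + t) = partialExcess f x s + partialExcess f (x + (s : ZMod m)) t := by
  simp only [partialExcess, sum_range_add]
  congr 1
  refine sum_congr rfl fun i _ => ?_
  push_cast
  rw [add_assoc]

theorem partialExcess_succ (f : ZMod m → ℕ) (x : ZMod m) (t : ℕ) :
    partialExcess f x (t + 1) = f x - 1 + partialExcess f (x + 1) t := by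
  rw [add_comm t 1, partialExcess_add]
  simp [partialExcess]

/-- The windows from `x` on are the regular ones, see `isRegular`. -/
def RegularAt (A B : ZMod m → ℕ) (x : ZMod m) : Prop :=
  history A x = 66 ∧ history B x = 4

variable {A B : ZMod m → ℕ} {leaf : ℕ → ℕ → Bool} {visit : ℕ → ℕ → ℕ → ℕ → ℕ → Bool}
  {goal : ℕ → ℕ → Bool}

theorem search_succ (hD : IsDominatingPair A B) {n p q : ℕ} {x : ZMod m}
    (h : search leaf visit goal (n + 1) (history A x) (history B x) p q = true)
    (hp : multV A B x - 1 ≤ p) (hq : multU A B x - 1 ≤ q) :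
    (RegularAt A B (x + 1) ∧ goal (p - (multV A B x - 1)) (q - (multU A B x - 1)) = true) ∨
    (¬RegularAt A B (x + 1) ∧
      visit n (history A (x + 1)) (history B (x + 1)) (p - (multV A B x - 1))
        (q - (multU A B x - 1)) = true ∧
      search leaf visit goal n (history A (x + 1)) (history B (x + 1)) (p - (multV A B x - 1))
        (q - (multU A B x - 1)) = true) := by
  have hV := hD.one_le_multV x
  have hU := hD.one_le_multU x
  have key : (bif Nat.ble 1 (multV A B x) && (Nat.ble (multV A B x) (p + 1) &&
          (Nat.ble 1 (multU A B x) && Nat.ble (multU A B x) (q + 1))) then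
        bif isRegular (history A (x + 1)) (history B (x + 1)) then
          goal (p + 1 - multV A B x) (q + 1 - multU A B x)
        else
          visit n (history A (x + 1)) (history B (x + 1)) (p + 1 - multV A B x)
            (q + 1 - multU A B x) &&
          search leaf visit goal n (history A (x + 1)) (history B (x + 1))
            (p + 1 - multV A B x) (q + 1 - multU A B x)
      else true) = true := by
    rw [← shift_history hD.left_le_one, ← shift_history hD.right_le_one,
      ← coverV_history hD.left_le_one, ← coverU_history hD.left_le_one hD.right_le_one]
    simp only [search, Bool.and_eq_true] at h
    obtain ⟨h00, h01, h10, h11⟩ := h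
    obtain ha | ha := Nat.le_one_iff_eq_zero_or_eq_one.1 (hD.left_le_one (x + 7)) <;>
    obtain hb | hb := Nat.le_one_iff_eq_zero_or_eq_one.1 (hD.right_le_one (x + 7)) <;>
    rw [ha, hb] <;> assumption
  have hc : (Nat.ble 1 (multV A B x) && (Nat.ble (multV A B x) (p + 1) &&
          (Nat.ble 1 (multU A B x) && Nat.ble (multU A B x) (q + 1)))) = true := by
    simp only [Bool.and_eq_true, Nat.ble_eq]
    omega
  have ep : p + 1 - multV A B x = p - (multV A B x - 1) := by omega
  have eq : q + 1 - multU A B x = q - (multU A B x - 1) := by omega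
  rw [hc, cond_true, ep, eq] at key
  cases hr : isRegular (history A (x + 1)) (history B (x + 1)) with
  | true =>
    rw [hr, cond_true] at key
    exact Or.inl ⟨(isRegular_iff _ _).1 hr, key⟩
  | false =>
    rw [hr, cond_false, Bool.and_eq_true] at key
    refine Or.inr ⟨fun h => ?_, key⟩
    rw [(isRegular_iff _ _).2 h] at hr
    exact absurd hr (by decide)

/-- What a successful search says about an actual dominating pair whose surpluses over the `L` steps
from `x` on are within the allowances. -/
theorem search_sound (hD : IsDominatingPair A B) (n : ℕ) :
    ∀ (x : ZMod m) (p q L : ℕ),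
      search leaf visit goal n (history A x) (history B x) p q = true →
      partialExcess (multV A B) x L ≤ p → partialExcess (multU A B) x L ≤ q →
      (∃ t, 1 ≤ t ∧ t ≤ L ∧ RegularAt A B (x + (t : ZMod m)) ∧
        goal (p - partialExcess (multV A B) x t) (q - partialExcess (multU A B) x t) = true) ∨
      ((n ≤ L → leaf (history A (x + (n : ZMod m))) (history B (x + (n : ZMod m))) = true) ∧
        ∀ t, 1 ≤ t → t ≤ L → t ≤ n →
          ¬RegularAt A B (x + (t : ZMod m)) ∧
          visit (n - t) (history A (x + (t : ZMod m))) (history B (x + (t : ZMod m)))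
            (p - partialExcess (multV A B) x t) (q - partialExcess (multU A B) x t) = true) := by
  induction n with
  | zero =>
    intro x p q L h _ _
    refine Or.inr ⟨fun _ => by simpa [search] using h, fun t h1 _ h2 => by omega⟩
  | succ n ih =>
    intro x p q L h hp hq
    cases L with
    | zero => exact Or.inr ⟨fun h => by omega, fun t h1 h2 => by omega⟩
    | succ L =>
      have hx : ∀ t : ℕ, x + 1 + (t : ZMod m) = x + ((t + 1 : ℕ) : ZMod m) := by
        intro t; push_cast; ring
      rw [partialExcess_succ] at hp hq
      obtain ⟨hr, hg⟩ | ⟨hr, hv, hs⟩ := search_succ hD h (by omega) (by omega)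
      · refine Or.inl ⟨1, le_rfl, by omega, by simpa using hr, ?_⟩
        simpa [partialExcess] using hg
      · obtain ⟨t, h1, h2, h3, h4⟩ | ⟨h1, h2⟩ := ih (x + 1) _ _ L hs (by omega) (by omega)
        · refine Or.inl ⟨t + 1, by omega, by omega, hx t ▸ h3, ?_⟩
          rw [partialExcess_succ, partialExcess_succ, Nat.sub_add_eq, Nat.sub_add_eq]
          exact h4
        · refine Or.inr ⟨fun h => hx n ▸ h1 (by omega), fun t ht1 ht2 ht3 => ?_⟩
          obtain ⟨t, rfl⟩ : ∃ s, t = s + 1 := ⟨t - 1, by omega⟩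
          rcases t with _ | t
          · exact ⟨by simpa using hr, by simpa [partialExcess] using hv⟩
          · have := h2 (t + 1) (by omega) (by omega) (by omega)
            rw [hx] at this
            rw [partialExcess_succ _ x (t + 1), partialExcess_succ _ x (t + 1), Nat.sub_add_eq p,
              Nat.sub_add_eq q, Nat.add_sub_add_right]
            exact this

end Walk

section Cycle

variable {m : ℕ} {A B : ZMod m → ℕ}

theorem history_lt (hA : ∀ z, A z ≤ 1) (x : ZMod m) : history A x < 128 := by
  have := hA x; have := hA (x + 1); have := hA (x + 2); have := hA (x + 3); have := hA (x + 4)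
  have := hA (x + 5); have := hA (x + 6)
  rw [history]
  omega

/-- The relation of surpluses that `returnSearch_eq_true` gives for a first return to the regular
windows extends to all returns, since it is additive. -/
theorem excess_of_regularAt (hD : IsDominatingPair A B) (L : ℕ) :
    ∀ x : ZMod m, RegularAt A B x → RegularAt A B (x + (L : ZMod m)) →
      partialExcess (multV A B) x L ≤ 2 → partialExcess (multU A B) x L ≤ 5 →
      partialExcess (multU A B) x L = 4 * partialExcess (multV A B) x L := by
  induction L using Nat.strong_induction_on with
  | _ L ih =>
    intro x hx hxL hp hq
    rcases Nat.eq_zero_or_pos L with rfl | hL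
    · simp [partialExcess]
    have hs : search (fun _ _ => false) (fun _ _ _ _ _ => true)
        (fun p q => Nat.beq (q + 3) (4 * p)) 20 (history A x) (history B x) 2 5 = true := by
      rw [hx.1, hx.2]
      exact returnSearch_eq_true
    obtain ⟨t, ht1, ht2, ht3, ht4⟩ | ⟨hleaf, hvisit⟩ := search_sound hD 20 x 2 5 L hs hp hq
    · obtain ⟨s, rfl⟩ : ∃ s, L = t + s := ⟨L - t, by omega⟩
      rw [partialExcess_add] at hp hq ⊢
      rw [partialExcess_add]
      have := ih s (by omega) (x + (t : ZMod m)) ht3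
        (by rwa [Nat.cast_add, ← add_assoc] at hxL) (by omega) (by omega)
      have := Nat.eq_of_beq_eq_true ht4
      omega
    · by_cases h : 20 ≤ L
      · exact absurd (hleaf h) (by decide)
      · exact absurd hxL (hvisit L hL le_rfl (by omega)).1

theorem sum_range_shift [NeZero m] (f : ZMod m → ℕ) (x : ZMod m) :
    ∑ i ∈ range m, f (x + (i : ZMod m)) = ∑ z, f z := by
  rw [← Equiv.sum_comp (Equiv.addLeft x) f]
  refine sum_bij (fun i _ => (i : ZMod m)) (fun _ _ => mem_univ _) ?_ ?_ (fun _ _ => rfl)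
  · intro i hi j hj h
    rw [mem_range] at hi hj
    have := congrArg ZMod.val h
    rwa [ZMod.val_natCast_of_lt hi, ZMod.val_natCast_of_lt hj] at this
  · intro z _
    exact ⟨z.val, mem_range.2 (ZMod.val_lt z), ZMod.natCast_zmod_val z⟩

theorem sum_shift [NeZero m] (f : ZMod m → ℕ) (c : ZMod m) : ∑ z, f (z + c) = ∑ z, f z :=
  Equiv.sum_comp (Equiv.addRight c) f

/-- Unless the cycle is very short, a dominating pair of small surplus which is unbalanced
(`u ≠ 4 * v`) shows the regular windows somewhere. -/
theorem exists_regularAt [NeZero m] (hD : IsDominatingPair A B) {v u : ℕ}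
    (hv : ∑ z, (multV A B z - 1) = v) (hu : ∑ z, (multU A B z - 1) = u)
    (hv2 : v ≤ 2) (hu5 : u ≤ 5) (hm : 2 * (v + u) < m) (h9 : m ≠ 9) (h18 : m ≠ 18)
    (hne : u ≠ 4 * v) : ∃ x, RegularAt A B x := by
  have htotV : ∀ x, partialExcess (multV A B) x m = v := fun x =>
    (sum_range_shift (fun z => multV A B z - 1) x).trans hv
  have htotU : ∀ x, partialExcess (multU A B) x m = u := fun x =>
    (sum_range_shift (fun z => multU A B z - 1) x).trans hu
  -- Each surplus spoils at most two of the `m` pairs of successive positions, and `2 (v + u) < m`.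
  obtain ⟨x, hx⟩ : ∃ x, (multV A B x - 1 + (multU A B x - 1)) +
      (multV A B (x + 1) - 1 + (multU A B (x + 1) - 1)) = 0 := by
    by_contra! h
    have hsum := sum_le_sum fun z (_ : z ∈ univ) => Nat.one_le_iff_ne_zero.2 (h z)
    simp only [sum_add_distrib] at hsum
    rw [sum_shift (fun z => multV A B z - 1), sum_shift (fun z => multU A B z - 1), hv, hu,
      sum_const, card_univ, ZMod.card, smul_eq_mul] at hsum
    omega
  have hV2 : partialExcess (multV A B) x 2 ≤ 0 := by
    simp only [partialExcess, sum_range_succ, range_zero, sum_empty]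
    push_cast
    rw [add_zero]
    omega
  have hU2 : partialExcess (multU A B) x 2 ≤ 0 := by
    simp only [partialExcess, sum_range_succ, range_zero, sum_empty]
    push_cast
    rw [add_zero]
    omega
  have hcalm : calmSearch (history A x) (history B x) = true :=
    of_allBelow (of_allBelow calmSearch_eq_true (history_lt hD.left_le_one x))
      (history_lt hD.right_le_one x)
  obtain ⟨t, -, -, ht, -⟩ | ⟨hclosed, -⟩ := search_sound hD 2 x 0 0 2 hcalm hV2 hU2
  · exact ⟨_, ht⟩
  generalize x + ((2 : ℕ) : ZMod m) = y at hclosed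
  obtain ⟨t, -, -, ht, -⟩ | ⟨hleaf, hvisit⟩ := search_sound hD 33 y 2 5 m (hclosed le_rfl)
    ((htotV y).trans_le hv2) ((htotU y).trans_le hu5)
  · exact ⟨_, ht⟩
  -- A full turn of `m` steps leads from the windows at `y` back to themselves.
  by_cases h : 33 ≤ m
  · exact absurd (hleaf h) (by decide)
  · have := (hvisit m (by omega) le_rfl (by omega)).2
    rw [ZMod.natCast_self, add_zero, htotV, htotU] at this
    simp only [closingTest, Bool.or_eq_true, Bool.not_eq_true', Bool.and_eq_false_iff,
      Nat.beq_eq, Nat.ble_eq] at this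
    simp at this
    omega

theorem sum_multV [NeZero m] (A B : ZMod m → ℕ) :
    ∑ z, multV A B z = 4 * ∑ z, A z + ∑ z, B z := by
  simp only [multV, sum_add_distrib, sum_shift]
  ring

theorem sum_multU [NeZero m] (A B : ZMod m → ℕ) :
    ∑ z, multU A B z = ∑ z, A z + 4 * ∑ z, B z := by
  simp only [multU, sum_add_distrib, sum_shift]
  ring

theorem sum_sub_one_add [NeZero m] {f : ZMod m → ℕ} (hf : ∀ z, 1 ≤ f z) :
    ∑ z, (f z - 1) + m = ∑ z, f z := by
  have h := sum_congr rfl fun z (_ : z ∈ univ) => Nat.sub_add_cancel (hf z)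
  rwa [sum_add_distrib, sum_const, card_univ, ZMod.card, smul_eq_mul, mul_one] at h

/-- A dominating pair of small surplus is balanced: the surpluses `v = 4 |A| + |B| - m` and
`u = |A| + 4 |B| - m` satisfy `4 v - u = 3 (5 |A| - m)`, so the claim is that `u = 4 v`.
The hypothesis `hm` says that `2 (v + u) < m`. -/
theorem eq_five_mul [NeZero m] (hD : IsDominatingPair A B) (hm9 : m ≠ 9) (hm18 : m ≠ 18)
    (hv : 4 * ∑ z, A z + ∑ z, B z ≤ m + 2) (hu : ∑ z, A z + 4 * ∑ z, B z ≤ m + 5)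
    (hm : 10 * (∑ z, A z + ∑ z, B z) < 5 * m) : m = 5 * ∑ z, A z := by
  have hV := sum_sub_one_add hD.one_le_multV
  have hU := sum_sub_one_add hD.one_le_multU
  rw [sum_multV] at hV
  rw [sum_multU] at hU
  by_contra hne
  obtain ⟨x, hx⟩ := exists_regularAt hD rfl rfl (by omega) (by omega) (by omega) hm9 hm18
    (by omega)
  have key := excess_of_regularAt hD m x hx (by simpa using hx)
  have htotV : partialExcess (multV A B) x m = _ := sum_range_shift (fun z => multV A B z - 1) x
  have htotU : partialExcess (multU A B) x m = _ := sum_range_shift (fun z => multU A B z - 1) x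
  rw [htotV, htotU] at key
  have := key (by omega) (by omega)
  omega

end Cycle

/-! ### The lower bound -/

section Graph

variable {n : ℕ} [NeZero (n / 2)]

/-- The residues modulo `n / 2` as indices of the vertices on one side of the Knödel graph. -/
def toFin : ZMod (n / 2) ≃ Fin (n / 2) where
  toFun z := ⟨z.val, ZMod.val_lt z⟩
  invFun i := (i : ℕ)
  left_inv z := ZMod.natCast_zmod_val z
  right_inv i := Fin.ext (ZMod.val_natCast_of_lt i.2)

theorem eq_add_natCast_iff (z w : ZMod (n / 2)) (c : ℕ) :
    w.val = (z.val + c) % (n / 2) ↔ w = z + (c : ZMod (n / 2)) := by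
  rw [← (ZMod.val_injective (n / 2)).eq_iff, ZMod.val_add, ZMod.val_natCast, Nat.add_mod_mod]

theorem adj_toFin_iff (z w : ZMod (n / 2)) :
    (knodelGraph 4 n).Adj (Sum.inl (toFin z)) (Sum.inr (toFin w)) ↔
      w = z ∨ w = z + 1 ∨ w = z + 3 ∨ w = z + 7 := by
  have h : (knodelGraph 4 n).Adj (Sum.inl (toFin z)) (Sum.inr (toFin w)) ↔
      ∃ k < 4, w.val = (z.val + 2 ^ k - 1) % (n / 2) := Iff.rfl
  have h0 := eq_add_natCast_iff z w 0
  have h1 := eq_add_natCast_iff z w 1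
  have h3 := eq_add_natCast_iff z w 3
  have h7 := eq_add_natCast_iff z w 7
  push_cast at h0 h1 h3 h7
  rw [add_zero, add_zero] at h0
  rw [h, ← h0, ← h1, ← h3, ← h7]
  constructor
  · rintro ⟨k, hk, h⟩
    interval_cases k
    exacts [Or.inl h, Or.inr (Or.inl h), Or.inr (Or.inr (Or.inl h)), Or.inr (Or.inr (Or.inr h))]
  · rintro (h | h | h | h)
    exacts [⟨0, by norm_num, h⟩, ⟨1, by norm_num, h⟩, ⟨2, by norm_num, h⟩, ⟨3, by norm_num, h⟩]

open Classical in
/-- The indicator function of the vertices `(1, z)` in `D`. -/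
def leftIndicator (D : Finset (Fin (n / 2) ⊕ Fin (n / 2))) (z : ZMod (n / 2)) : ℕ :=
  if Sum.inl (toFin z) ∈ D then 1 else 0

open Classical in
/-- The indicator function of the vertices `(2, z)` in `D`. -/
def rightIndicator (D : Finset (Fin (n / 2) ⊕ Fin (n / 2))) (z : ZMod (n / 2)) : ℕ :=
  if Sum.inr (toFin z) ∈ D then 1 else 0

theorem sum_indicator (D : Finset (Fin (n / 2) ⊕ Fin (n / 2))) :
    ∑ z, leftIndicator D z + ∑ z, rightIndicator D z = D.card := by
  classical
  have : D.card = ∑ v, if v ∈ D then 1 else 0 := by simp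
  rw [this, Fintype.sum_sum_type, ← toFin.sum_comp, ← toFin.sum_comp]
  simp only [leftIndicator, rightIndicator]

theorem IsDominatingPair.of_isDominatingSet {D : Finset (Fin (n / 2) ⊕ Fin (n / 2))}
    (hD : IsDominatingSet (knodelGraph 4 n) D) :
    IsDominatingPair (leftIndicator D) (rightIndicator D) where
  left_le_one z := by unfold leftIndicator; split_ifs <;> simp
  right_le_one z := by unfold rightIndicator; split_ifs <;> simp
  one_le_multV z := by
    by_cases h : Sum.inr (toFin (z + 7)) ∈ D
    · simp [multV, rightIndicator, h]
    obtain ⟨v | v, hv, hadj⟩ := hD _ h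
    · obtain ⟨w, rfl⟩ := toFin.surjective v
      have hw : leftIndicator D w = 1 := by simp [leftIndicator, hv]
      have key : w = z + 7 ∨ w = z + 6 ∨ w = z + 4 ∨ w = z := by
        obtain h | h | h | h := (adj_toFin_iff w (z + 7)).1 hadj.symm
        · exact Or.inl h.symm
        · exact Or.inr (Or.inl (by linear_combination -h))
        · exact Or.inr (Or.inr (Or.inl (by linear_combination -h)))
        · exact Or.inr (Or.inr (Or.inr (by linear_combination -h)))
      unfold multV
      obtain rfl | rfl | rfl | rfl := key <;> omega
    · exact hadj.elim
  one_le_multU z := by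
    by_cases h : Sum.inl (toFin z) ∈ D
    · simp only [multU, leftIndicator, h, if_true]
      omega
    obtain ⟨v | v, hv, hadj⟩ := hD _ h
    · exact hadj.elim
    · obtain ⟨w, rfl⟩ := toFin.surjective v
      have hw : rightIndicator D w = 1 := by simp [rightIndicator, hv]
      unfold multU
      obtain rfl | rfl | rfl | rfl := (adj_toFin_iff z w).1 hadj <;> omega

/-- Transport along the automorphism of the Knödel graph that exchanges `(1, z)` and `(2, -z)`. -/
theorem IsDominatingPair.reflect {m : ℕ} {A B : ZMod m → ℕ} (hD : IsDominatingPair A B) :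
    IsDominatingPair (fun z => B (-z)) (fun z => A (-z)) where
  left_le_one z := hD.right_le_one _
  right_le_one z := hD.left_le_one _
  one_le_multV z := by
    have h := hD.one_le_multU (-(z + 7))
    have e1 : -(z + 7) + 1 = -(z + 6) := by ring
    have e2 : -(z + 7) + 3 = -(z + 4) := by ring
    have e3 : -(z + 7) + 7 = -z := by ring
    simp only [multU, multV, e1, e2, e3] at h ⊢
    omega
  one_le_multU z := by
    have h := hD.one_le_multV (-(z + 7))
    have e1 : -(z + 7) + 4 = -(z + 3) := by ring
    have e2 : -(z + 7) + 6 = -(z + 1) := by ring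
    have e3 : -(z + 7) + 7 = -z := by ring
    simp only [multU, multV, e1, e2, e3] at h ⊢
    omega

/-- Counting alone, `m ≤ 4 |A| + |B|` and `m ≤ |A| + 4 |B|`, shows that a pair smaller than
claimed has surpluses `(0, 3)`, `(2, 2)`, `(1, 1)` or `(2, 5)`, in one of the two orders. Then
`eq_five_mul`, for the pair or its reflection, contradicts the residue of `m` modulo 5. -/
theorem IsDominatingPair.lower_bound {m : ℕ} [NeZero m] {A B : ZMod m → ℕ}
    (hD : IsDominatingPair A B) (hm : 8 ≤ m) :
    2 * m ≤ 5 * (∑ z, A z + ∑ z, B z) ∧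
    (m % 5 = 1 → 2 * (m / 5) + 2 ≤ ∑ z, A z + ∑ z, B z) ∧
    (m % 5 = 2 → 2 * (m / 5) + 2 ≤ ∑ z, A z + ∑ z, B z) ∧
    (m % 5 = 3 → m ≠ 8 → m ≠ 18 → 2 * (m / 5) + 3 ≤ ∑ z, A z + ∑ z, B z) ∧
    (m % 5 = 4 → m ≠ 9 → 2 * (m / 5) + 3 ≤ ∑ z, A z + ∑ z, B z) ∧
    (m % 5 = 4 → m ≠ 9 → m ≠ 14 → 2 * (m / 5) + 4 ≤ ∑ z, A z + ∑ z, B z) := by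
  have hV := sum_sub_one_add hD.one_le_multV
  have hU := sum_sub_one_add hD.one_le_multU
  rw [sum_multV] at hV
  rw [sum_multU] at hU
  have h1 := eq_five_mul hD
  have h2 := eq_five_mul hD.reflect
  have hA : ∑ z, A (-z) = ∑ z, A z := Equiv.sum_comp (Equiv.neg _) A
  have hB : ∑ z, B (-z) = ∑ z, B z := Equiv.sum_comp (Equiv.neg _) B
  rw [hA, hB] at h2
  clear hA hB
  generalize ∑ z, A z = a at *
  generalize ∑ z, B z = b at *
  generalize ∑ z, (multV A B z - 1) = v at *
  generalize ∑ z, (multU A B z - 1) = u at *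
  refine ⟨by omega, fun h => ?_, fun h => ?_, fun h _ _ => ?_, fun h _ => ?_, fun h _ _ => ?_⟩ <;>
    by_contra! hlt <;> omega

end Graph

/-! ### The upper bound -/

theorem dominationNumber_le {V : Type*} [Fintype V] {G : SimpleGraph V} {D : Finset V}
    (hD : IsDominatingSet G D) : dominationNumber G ≤ D.card :=
  Nat.sInf_le ⟨D, hD, rfl⟩

/-- A dominating set is given by the sets `P` and `Q` of the indices of its vertices on the two
sides. Reduction modulo `n / 2` is spelled out as at most one subtraction. -/
theorem dominationNumber_knodelGraph_le {n : ℕ} (hn : 8 ≤ n / 2) (P Q : Finset ℕ)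
    (hP : ∀ x ∈ P, x < n / 2) (hQ : ∀ y ∈ Q, y < n / 2)
    (hU : ∀ x < n / 2, x ∈ P ∨ ∃ k < 4, x + 2 ^ k - 1 ∈ Q ∨
      n / 2 ≤ x + 2 ^ k - 1 ∧ x + 2 ^ k - 1 - n / 2 ∈ Q)
    (hV : ∀ y < n / 2, y ∈ Q ∨ ∃ k < 4, 2 ^ k - 1 ≤ y ∧ y - (2 ^ k - 1) ∈ P ∨
      y + n / 2 - (2 ^ k - 1) ∈ P) :
    dominationNumber (knodelGraph 4 n) ≤ P.card + Q.card := by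
  classical
  have hcard : ∀ S : Finset ℕ, (univ.filter fun i : Fin (n / 2) => (i : ℕ) ∈ S).card ≤ S.card :=
    fun S => card_le_card_of_injOn Fin.val (fun i hi => (mem_filter.1 hi).2)
      Fin.val_injective.injOn
  refine (dominationNumber_le (D := (univ.filter fun i : Fin (n / 2) => (i : ℕ) ∈ P).disjSum
    (univ.filter fun i : Fin (n / 2) => (i : ℕ) ∈ Q)) ?_).trans ?_
  · rintro (i | j) hu
    · simp only [inl_mem_disjSum, mem_filter, mem_univ, true_and] at hu
      obtain h | ⟨k, hk, h⟩ := hU i i.2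
      · exact absurd h hu
      obtain h | ⟨hle, h⟩ := h
      · refine ⟨Sum.inr ⟨_, hQ _ h⟩, by simpa using h, k, hk, ?_⟩
        exact (Nat.mod_eq_of_lt (hQ _ h)).symm
      · refine ⟨Sum.inr ⟨_, hQ _ h⟩, by simpa using h, k, hk, ?_⟩
        rw [Nat.mod_eq_sub_mod hle]
        exact (Nat.mod_eq_of_lt (hQ _ h)).symm
    · simp only [inr_mem_disjSum, mem_filter, mem_univ, true_and] at hu
      obtain h | ⟨k, hk, h⟩ := hV j j.2
      · exact absurd h hu
      have hpos : 1 ≤ 2 ^ k := Nat.one_le_two_pow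
      obtain ⟨hle, h⟩ | h := h
      · refine ⟨Sum.inl ⟨_, hP _ h⟩, by simpa using h, k, hk, ?_⟩
        change (j : ℕ) = ((j : ℕ) - (2 ^ k - 1) + 2 ^ k - 1) % (n / 2)
        rw [show (j : ℕ) - (2 ^ k - 1) + 2 ^ k - 1 = j by omega, Nat.mod_eq_of_lt j.2]
      · refine ⟨Sum.inl ⟨_, hP _ h⟩, by simpa using h, k, hk, ?_⟩
        change (j : ℕ) = ((j : ℕ) + n / 2 - (2 ^ k - 1) + 2 ^ k - 1) % (n / 2)
        have hk8 : 2 ^ k ≤ 8 := by interval_cases k <;> norm_num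
        rw [show (j : ℕ) + n / 2 - (2 ^ k - 1) + 2 ^ k - 1 = j + n / 2 by omega,
          Nat.add_mod_right, Nat.mod_eq_of_lt j.2]
  · rw [card_disjSum]
    exact add_le_add (hcard P) (hcard Q)

/-- The numbers `5 i + c` with `i < t`. -/
def progression (t c : ℕ) : Finset ℕ := (range t).image fun i => 5 * i + c

theorem mem_progression {t c x : ℕ} : x ∈ progression t c ↔ ∃ i < t, x = 5 * i + c := by
  simp [progression, eq_comm]

theorem card_progression_le (t c : ℕ) : (progression t c).card ≤ t :=
  card_image_le.trans (card_range t).le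

theorem mem_progression_zero {t x : ℕ} : x ∈ progression t 0 ↔ x % 5 = 0 ∧ x < 5 * t := by
  rw [mem_progression]
  exact ⟨fun ⟨i, hi, h⟩ => by omega, fun h => ⟨x / 5, by omega, by omega⟩⟩

theorem mem_progression_four {t x : ℕ} : x ∈ progression t 4 ↔ x % 5 = 4 ∧ x < 5 * t := by
  rw [mem_progression]
  exact ⟨fun ⟨i, hi, h⟩ => by omega, fun h => ⟨x / 5, by omega, by omega⟩⟩

theorem exists_lt_four {p : ℕ → Prop} : (∃ k < 4, p k) ↔ p 0 ∨ p 1 ∨ p 2 ∨ p 3 := by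
  constructor
  · rintro ⟨k, hk, h⟩
    interval_cases k <;> simp [h]
  · rintro (h | h | h | h)
    exacts [⟨0, by norm_num, h⟩, ⟨1, by norm_num, h⟩, ⟨2, by norm_num, h⟩, ⟨3, by norm_num, h⟩]

/-- The domination number is bounded by means of the period 5 pattern with `t` vertices on each side
and the additional vertices `X` and `Y`. -/
theorem dominationNumber_le_of_insert {n t : ℕ} (hn : 8 ≤ n / 2) (ht : 5 * t ≤ n / 2)
    (X Y : Finset ℕ) (hX : ∀ x ∈ X, x < n / 2) (hY : ∀ y ∈ Y, y < n / 2)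
    (hU : ∀ x < n / 2, x ∈ progression t 0 ∪ X ∨ ∃ k < 4, x + 2 ^ k - 1 ∈ progression t 4 ∪ Y ∨
      n / 2 ≤ x + 2 ^ k - 1 ∧ x + 2 ^ k - 1 - n / 2 ∈ progression t 4 ∪ Y)
    (hV : ∀ y < n / 2, y ∈ progression t 4 ∪ Y ∨ ∃ k < 4,
      2 ^ k - 1 ≤ y ∧ y - (2 ^ k - 1) ∈ progression t 0 ∪ X ∨
      y + n / 2 - (2 ^ k - 1) ∈ progression t 0 ∪ X) :
    dominationNumber (knodelGraph 4 n) ≤ 2 * t + (X.card + Y.card) := by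
  have h := dominationNumber_knodelGraph_le hn _ _
    (fun x hx => (mem_union.1 hx).elim (fun h => by rw [mem_progression_zero] at h; omega) (hX x))
    (fun y hy => (mem_union.1 hy).elim (fun h => by rw [mem_progression_four] at h; omega) (hY y))
    hU hV
  have := card_union_le (progression t 0) X
  have := card_union_le (progression t 4) Y
  have := card_progression_le t 0
  have := card_progression_le t 4
  omega

set_option maxHeartbeats 2000000 in
/-- In each residue class modulo 5, the perfect pattern of period 5 is completed by at most four
vertices near the place where it closes up. -/
theorem dominationNumber_knodelGraph_le_of_residue {n t : ℕ} (ht : 2 ≤ t) :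
    (n / 2 = 5 * t → dominationNumber (knodelGraph 4 n) ≤ 2 * t) ∧
    (n / 2 = 5 * t + 1 → dominationNumber (knodelGraph 4 n) ≤ 2 * t + 2) ∧
    (n / 2 = 5 * t + 2 → dominationNumber (knodelGraph 4 n) ≤ 2 * t + 2) ∧
    (n / 2 = 5 * t + 3 → dominationNumber (knodelGraph 4 n) ≤ 2 * t + 3) ∧
    (n / 2 = 5 * t + 4 → dominationNumber (knodelGraph 4 n) ≤ 2 * t + 4) := by
  refine
    ⟨fun hm => dominationNumber_le_of_insert (by omega) (by omega) ∅ ∅ (by simp) (by simp) ?_ ?_,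
    fun hm => dominationNumber_le_of_insert (by omega) (by omega) {1} {5 * t}
      (by simp; omega) (by simp; omega) ?_ ?_,
    fun hm => dominationNumber_le_of_insert (by omega) (by omega) {5 * t + 1} {5 * t}
      (by simp; omega) (by simp; omega) ?_ ?_,
    fun hm => (dominationNumber_le_of_insert (by omega) (by omega) {5 * t + 1, 5 * t + 2} {5 * t}
      (by simp; omega) (by simp; omega) ?_ ?_).trans
        (Nat.add_le_add_left (add_le_add card_le_two (card_singleton _).le) _),
    fun hm => (dominationNumber_le_of_insert (by omega) (by omega) {1, 5 * t + 1} {5 * t, 5 * t + 3}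
      (by simp; omega) (by simp; omega) ?_ ?_).trans
        (Nat.add_le_add_left (add_le_add card_le_two card_le_two) _)⟩
  all_goals
    simp only [exists_lt_four, mem_union, mem_progression_zero, mem_progression_four, mem_insert,
      mem_singleton, notMem_empty, or_false, hm]
    intro x hx
    obtain hc | hc | hc | hc | hc : x % 5 = 0 ∨ x % 5 = 1 ∨ x % 5 = 2 ∨ x % 5 = 3 ∨ x % 5 = 4 := by
      omega
  -- Away from both ends of the range, the residue of `x` determines a vertex that dominates it.
  all_goals
    obtain hb | hb | hb | hb : x < 5 ∨ (5 ≤ x ∧ x + 5 < 5 * t) ∨ (5 * t ≤ x + 5 ∧ x < 5 * t) ∨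
      5 * t ≤ x := by omega
  all_goals
    first
    | exact Or.inl (by omega)
    | exact Or.inr (Or.inl (by omega))
    | exact Or.inr (Or.inr (Or.inl (by omega)))
    | exact Or.inr (Or.inr (Or.inr (Or.inl (by omega))))
    | exact Or.inr (Or.inr (Or.inr (Or.inr (by omega))))

theorem dominationNumber_knodelGraph_16_le : dominationNumber (knodelGraph 4 16) ≤ 4 :=
  dominationNumber_knodelGraph_le (by norm_num) {0, 1} {5, 6} (by decide) (by decide) (by decide)
    (by decide)

theorem dominationNumber_knodelGraph_18_le : dominationNumber (knodelGraph 4 18) ≤ 4 :=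
  dominationNumber_knodelGraph_le (by norm_num) {0, 1} {5, 6} (by decide) (by decide) (by decide)
    (by decide)

theorem dominationNumber_knodelGraph_28_le : dominationNumber (knodelGraph 4 28) ≤ 7 :=
  dominationNumber_knodelGraph_le (by norm_num) {0, 1, 5} {9, 10, 11, 13} (by decide) (by decide)
    (by decide) (by decide)

theorem dominationNumber_knodelGraph_36_le : dominationNumber (knodelGraph 4 36) ≤ 8 :=
  dominationNumber_knodelGraph_le (by norm_num) {0, 1, 9, 10} {5, 6, 14, 15} (by decide)
    (by decide) (by decide) (by decide)

end Knodel

theorem mainTheorem1 (n : ℕ) (hn : 16 ≤ n) (heven : Even n) :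
    (n % 10 = 0 →
      dominationNumber (knodelGraph 4 n) = 2 * (n / 10)) ∧
    (n = 16 ∨ n = 18 ∨ n = 36 ∨ n % 10 = 2 ∨ n % 10 = 4 →
      dominationNumber (knodelGraph 4 n) = 2 * (n / 10) + 2) ∧
    (n = 28 ∨ (n % 10 = 6 ∧ n ≠ 16 ∧ n ≠ 36) →
      dominationNumber (knodelGraph 4 n) = 2 * (n / 10) + 3) ∧
    (n % 10 = 8 ∧ n ≠ 18 ∧ n ≠ 28 →
      dominationNumber (knodelGraph 4 n) = 2 * (n / 10) + 4) := by
  obtain ⟨D, hD, hcard⟩ := exists_isDominatingSet_card_eq (knodelGraph 4 n)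
  have hm : 8 ≤ n / 2 := by omega
  have : NeZero (n / 2) := ⟨by omega⟩
  obtain ⟨h, h1, h2, h3, h4, h4'⟩ :=
    (Knodel.IsDominatingPair.of_isDominatingSet hD).lower_bound hm
  rw [Knodel.sum_indicator, hcard] at h h1 h2 h3 h4 h4'
  have hn10 : n / 2 / 5 = n / 10 := by omega
  have hmod : n % 10 = 2 * (n / 2 % 5) := by
    obtain ⟨k, rfl⟩ := heven
    omega
  have hup := Knodel.dominationNumber_knodelGraph_le_of_residue (n := n) (t := n / 10)
  refine ⟨fun hr => ?_, ?_, ?_, fun ⟨hr, h18, h28⟩ => ?_⟩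
  · have := (hup (by omega)).1 (by omega)
    omega
  · rintro (rfl | rfl | rfl | hr | hr)
    · have := Knodel.dominationNumber_knodelGraph_16_le
      omega
    · have := Knodel.dominationNumber_knodelGraph_18_le
      omega
    · have := Knodel.dominationNumber_knodelGraph_36_le
      omega
    · have := (hup (by omega)).2.1 (by omega)
      omega
    · have := (hup (by omega)).2.2.1 (by omega)
      omega
  · rintro (rfl | ⟨hr, h16, h36⟩)
    · have := Knodel.dominationNumber_knodelGraph_28_le
      omega
    · have := (hup (by omega)).2.2.2.1 (by omega)
      omega
  · have := (hup (by omega)).2.2.2.2 (by omega)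
    omega
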